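/- A topological dynamical system (tds) $(X,\varphi)$ is a compact metric space $X$ with a homeomorphism $\varphi$ of $X$. It is equicontinuous if the iterates $\varphi^n$, $n\in\mathbb{N}$, are uniformly equicontinuous, and uniquely ergodic if it has exactly one invariant Borel probability measure. A factor $(Y,\psi,\pi)$ of $(X,\varphi)$ is a tds $(Y,\psi)$ with a continuous surjection $\pi:X\to Y$ such that $\pi\circ\varphi=\psi\circ\pi$. It is a maximal equicontinuous factor (MEF) if $(Y,\psi)$ is equicontinuous and for every factor $(Z,\rho,p)$ of $(X,\varphi)$ with $(Z,\rho)$ equicontinuous there is a unique factor map $q$ from $(Y,\psi)$ to $(Z,\rho)$ with $p=q\circ\pi$. We say that $(X,\varphi)$ is an isomorphic extension of its factor $(Y,\psi,\pi)$ if both systems are uniquely ergodic, with invariant measures $\mu$ and $\nu$, and $\pi$ is a measure-theoretic isomorphism from $(X,\mathcal{B}(X),\mu,\varphi)$ to $(Y,\mathcal{B}(Y),\nu,\psi)$, that is, $\pi_*\mu=\nu$ and $\pi$ restricts to a bi-measurable bijection $A\to B$ between Borel sets with $\mu(A)=\nu(B)=1$. **Proposition.** (1) Let $(X,\varphi)$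 be a tds and $(Y,\psi,\pi)$ a factor with $(Y,\psi)$ equicontinuous and uniquely ergodic (the latter is automatic if $(X,\varphi)$ is minimal or uniquely ergodic). Then $(Y,\psi,\pi)$ is a MEF of $(X,\varphi)$ and $(X,\varphi)$ is an isomorphic extension of $(Y,\psi,\pi)$ if and only if for every $\varepsilon>0$ there is an integer $K\ge 1$ such that for all $x,y\in X$ $$\pi(x)=\pi(y)\ \Longrightarrow\ \frac1K\sum_{i=0}^{K} d_X(\varphi^i(x),\varphi^i(y))<\varepsilon .$$ (2) Let $X,Y$ be compact metric spaces and $\pi:X\to Y$ a continuous surjection. Let $\mathcal{E}(\pi)$ be the set of homeomorphisms $\varphi$ of $X$ for which there is an equicontinuous homeomorphism $\psi$ of $Y$ with $\pi\circ\varphi=\psi\circ\pi$, with the topology of uniform convergence of homeomorphisms and their inverses. Then the set of those $\varphi\in\mathcal{E}(\pi)$ for which there is a homeomorphism $\psi$ of $Y$ such that $(Y,\psi,\pi)$ is a MEF of $(X,\varphi)$ and $(X,\varphi)$ is an isomorphic extension of $(Y,\psi,\pi)$ is a $G_\delta$ subset of $\mathcal{E}(\pi)$. -/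

import Mathlib

open MeasureTheory

namespace TDS

universe u v

/-- The topology on the homeomorphism group of a compact metric space: uniform convergence of
homeomorphisms together with their inverses (the topology of the metric
`d₀(φ, ψ) = max (d_sup(φ, ψ)) (d_sup(φ⁻¹, ψ⁻¹))`). -/
instance homeoTopology (X : Type u) [TopologicalSpace X] : TopologicalSpace (X ≃ₜ X) :=
  TopologicalSpace.induced
    (fun φ : X ≃ₜ X => ((φ : C(X, X)), (φ.symm : C(X, X)))) inferInstance

/-- `π` is a factor map from the system `(X, φ)` to the system `(Y, ψ)`. -/
structure IsFactor {X : Type u} {Y : Type v} [TopologicalSpace X] [TopologicalSpace Y]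
    (φ : X ≃ₜ X) (ψ : Y ≃ₜ Y) (π : X → Y) : Prop where
  continuous : Continuous π
  surjective : Function.Surjective π
  semiconj : ∀ x, π (φ x) = ψ (π x)

/-- Equicontinuity of `(Y, ψ)`: the forward iterates of `ψ` form a uniformly equicontinuous
family. -/
def IsEquicontinuous {Y : Type u} [MetricSpace Y] (ψ : Y ≃ₜ Y) : Prop :=
  UniformEquicontinuous (fun n : ℕ => (ψ : Y → Y)^[n])

/-- `(Y, ψ, π)` is a maximal equicontinuous factor of `(X, φ)`. Every factor of `X` is a quotient
of `X`, so it is enough to let the competing factors live in the universe of `X`. -/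
structure IsMaximalEquicontinuousFactor {X : Type u} {Y : Type v} [MetricSpace X] [MetricSpace Y]
    (φ : X ≃ₜ X) (ψ : Y ≃ₜ Y) (π : X → Y) : Prop where
  isFactor : IsFactor φ ψ π
  equicontinuous : IsEquicontinuous ψ
  maximal : ∀ (Z : Type u) [MetricSpace Z] [CompactSpace Z] (ρ : Z ≃ₜ Z) (p : X → Z),
    IsEquicontinuous ρ → IsFactor φ ρ p → ∃! q : Y → Z, IsFactor ψ ρ q ∧ p = q ∘ π

/-- `μ` is the unique invariant Borel probability measure of `(X, φ)`. -/
structure IsUniqueInvariantMeasure {X : Type u} [TopologicalSpace X] [MeasurableSpace X]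
    (φ : X ≃ₜ X) (μ : ProbabilityMeasure X) : Prop where
  invariant : MeasurePreserving φ (μ : Measure X) (μ : Measure X)
  unique : ∀ μ' : ProbabilityMeasure X,
    MeasurePreserving φ (μ' : Measure X) (μ' : Measure X) → μ' = μ

/-- `(X, φ)` is uniquely ergodic. -/
def UniquelyErgodic {X : Type u} [TopologicalSpace X] [MeasurableSpace X] (φ : X ≃ₜ X) : Prop :=
  ∃ μ : ProbabilityMeasure X, IsUniqueInvariantMeasure φ μ

/-- `h` is a measure-theoretic isomorphism from `(X, μ, φ)` to `(Y, ν, ψ)`: it is measurable,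
pushes `μ` to `ν`, and restricts to a bi-measurable bijection between measurable sets `A`, `B` of
full measure, intertwining the two maps on `A`. -/
structure IsMeasureIsomorphism {X : Type u} {Y : Type v} [MeasurableSpace X] [MeasurableSpace Y]
    (μ : ProbabilityMeasure X) (ν : ProbabilityMeasure Y)
    (φ : X → X) (ψ : Y → Y) (h : X → Y) : Prop where
  measurePreserving : MeasurePreserving h (μ : Measure X) (ν : Measure Y)
  exists_bijOn : ∃ (A : Set X) (B : Set Y), MeasurableSet A ∧ MeasurableSet B ∧
    μ A = 1 ∧ ν B = 1 ∧ Set.BijOn h A B ∧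
    (∀ S ⊆ A, MeasurableSet S → MeasurableSet (h '' S)) ∧
    ∀ x ∈ A, h (φ x) = ψ (h x)

/-- `(X, φ)` is an isomorphic extension of `(Y, ψ)` via `π`: both systems are uniquely ergodic and
`π` is a measure-theoretic isomorphism with respect to the unique invariant measures. -/
def IsIsomorphicExtension {X : Type u} {Y : Type v} [TopologicalSpace X] [TopologicalSpace Y]
    [MeasurableSpace X] [MeasurableSpace Y] (φ : X ≃ₜ X) (ψ : Y ≃ₜ Y) (π : X → Y) : Prop :=
  ∃ (μ : ProbabilityMeasure X) (ν : ProbabilityMeasure Y),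
    IsUniqueInvariantMeasure φ μ ∧ IsUniqueInvariantMeasure ψ ν ∧ IsMeasureIsomorphism μ ν φ ψ π

/-- For every `ε > 0` some finite-time average of the distance of two orbits is below `ε`,
simultaneously for all pairs of points in a common fibre of `π`. -/
def FibrewiseMeanSmall {X : Type u} {Y : Type v} [MetricSpace X] (φ : X ≃ₜ X) (π : X → Y) : Prop :=
  ∀ ε : ℝ, 0 < ε → ∃ K : ℕ, 1 ≤ K ∧ ∀ x y : X, π x = π y →
    (1 / (K : ℝ)) * ∑ i ∈ Finset.range (K + 1), dist ((φ : X → X)^[i] x) ((φ : X → X)^[i] y) < ε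

/-- The space of homeomorphisms of `X` that are extensions, via `π`, of some equicontinuous
homeomorphism of `Y`. -/
def extensions {X : Type u} {Y : Type v} [MetricSpace X] [MetricSpace Y] (π : X → Y) :
    Set (X ≃ₜ X) :=
  {φ | ∃ ψ : Y ≃ₜ Y, IsEquicontinuous ψ ∧ π ∘ φ = ψ ∘ π}

/-- Those `φ` in `extensions π` for which, with some `ψ`, `(Y, ψ, π)` is a maximal equicontinuous
factor and `(X, φ)` is an isomorphic extension of it. -/
def isoExtensions {X : Type u} {Y : Type v} [MetricSpace X] [MetricSpace Y]
    [MeasurableSpace X] [MeasurableSpace Y] (π : X → Y) : Set (extensions π) :=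
  {φ | ∃ ψ : Y ≃ₜ Y, IsMaximalEquicontinuousFactor φ.1 ψ π ∧ IsIsomorphicExtension φ.1 ψ π}

end TDS

/-!
The two halves of the first equivalence both rest on the fibre product of `X` with itself over `Y`
and on the invariant measures it carries.

If `X` is an isomorphic extension of `Y` but the averages of the distance do not become small
uniformly on the fibres, empirical measures of pairs of orbits accumulate at a self-joining of the
unique invariant measure `μ` which is carried by the fibre product and gives the distance a positive
integral (`TDS.exists_selfJoining`). As `π` is injective on a set of full measure, this joining is
carried by the diagonal, a contradiction (`TDS.IsIsomorphicExtension.fibrewiseMeanSmall`).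

Conversely, if these averages are small, every `φ × φ`-invariant probability measure on the fibre
product is carried by the diagonal (`TDS.FibrewiseMeanSmall.ae_fst_eq_snd`). Any two invariant
measures of `X` project to the invariant measure `ν` of `Y`. For their relatively independent
joining over `ν` this says that `ν`-almost all of their conditional measures are the same point
masses (`TDS.FibrewiseMeanSmall.exists_eq_dirac`): the two measures agree, and `π` is injective on
the set of points that are the atom of the conditional measure over their image
(`TDS.FibrewiseMeanSmall.isIsomorphicExtension`). Maximality of the equicontinuous factor needs no
measures: an equicontinuous system is distal, so points of one fibre of `π`, whose orbits come close
in mean, are identified in every equicontinuous factor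
(`TDS.FibrewiseMeanSmall.eq_of_equicontinuous`).

For the second part, `φ` belongs to the set in question if and only if the averages of the distance
become small on the fibres and `ψ` is uniquely ergodic. Unique ergodicity means that each function
from a countable dense subset of `C(Y, ℝ)` has averages of arbitrarily small oscillation, and by
compactness each single inequality of either kind, required at all points, defines an open set of
homeomorphisms.
-/

open Filter Topology ProbabilityTheory

namespace TDS

universe u v

/-! ### Averages and invariant measures -/

theorem integral_birkhoffAverage {Z : Type*} [MeasurableSpace Z] {T : Z → Z} {μ : Measure Z}
    (hT : MeasurePreserving T μ μ) {f : Z → ℝ} (hf : Integrable f μ) {n : ℕ} (hn : n ≠ 0) :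
    ∫ z, birkhoffAverage ℝ T f n z ∂μ = ∫ z, f z ∂μ := by
  simp only [birkhoffAverage, birkhoffSum, smul_eq_mul]
  rw [integral_const_mul, integral_finsetSum]
  · have h : ∀ i ∈ Finset.range n, ∫ z, f (T^[i] z) ∂μ = ∫ z, f z ∂μ := fun i _ => by
      have h := (hT.iterate i).map_eq
      conv_rhs => rw [← h]
      rw [integral_map (hT.iterate i).aemeasurable]
      rw [h]; exact hf.aestronglyMeasurable
    rw [Finset.sum_congr rfl h]
    simp [hn]
  · intro i _
    exact (hT.iterate i).integrable_comp_of_integrable hf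

/-- The empirical measure of the orbit segment `z, T z, …, T^[n-1] z`. -/
noncomputable def empiricalMeasure {Z : Type*} [MeasurableSpace Z] (T : Z → Z) (n : ℕ) (z : Z) :
    Measure Z :=
  (n : ENNReal)⁻¹ • ∑ i ∈ Finset.range n, Measure.dirac (T^[i] z)

theorem isProbabilityMeasure_empiricalMeasure {Z : Type*} [MeasurableSpace Z] (T : Z → Z) {n : ℕ}
    (hn : n ≠ 0) (z : Z) : IsProbabilityMeasure (empiricalMeasure T n z) := by
  constructor
  simp [empiricalMeasure]
  exact ENNReal.inv_mul_cancel (by simpa using hn) (by simp)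

theorem integral_empiricalMeasure {Z : Type*} [MeasurableSpace Z] (T : Z → Z) (n : ℕ) (z : Z)
    {f : Z → ℝ} (hf : StronglyMeasurable f) :
    ∫ w, f w ∂(empiricalMeasure T n z) = birkhoffAverage ℝ T f n z := by
  rw [empiricalMeasure, integral_smul_measure, integral_finsetSum_measure]
  · simp [birkhoffAverage, birkhoffSum, integral_dirac' f _ hf]
  · intro i _
    exact (integrable_dirac' hf (by simp))

/-- A form of the Krylov–Bogoliubov theorem that keeps track of lower bounds for averages along
the orbit segments from which the invariant measure is built. -/
theorem exists_invariant_measure {Z : Type*} [MetricSpace Z] [CompactSpace Z] [MeasurableSpace Z]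
    [BorelSpace Z] {T : Z → Z} (hT : Continuous T) (k : ℕ → ℕ) (hk0 : ∀ n, k n ≠ 0)
    (hk : Tendsto k atTop atTop) (z : ℕ → Z) :
    ∃ μ : ProbabilityMeasure Z, MeasurePreserving T (μ : Measure Z) (μ : Measure Z) ∧
      ∀ g : C(Z, ℝ), ∀ c : ℝ, (∀ n, c ≤ birkhoffAverage ℝ T g (k n) (z n)) →
        c ≤ ∫ w, g w ∂(μ : Measure Z) := by
  let m : ℕ → ProbabilityMeasure Z := fun n =>
    ⟨empiricalMeasure T (k n) (z n), isProbabilityMeasure_empiricalMeasure T (hk0 n) (z n)⟩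
  let U : Ultrafilter ℕ := Ultrafilter.of atTop
  have hU : (U : Filter ℕ) ≤ atTop := Ultrafilter.of_le atTop
  obtain ⟨μ, -, hμ⟩ := isCompact_univ.ultrafilter_le_nhds (U.map m) (by simp)
  have hμ' : Tendsto m U (𝓝 μ) := hμ
  rw [ProbabilityMeasure.tendsto_iff_forall_integral_tendsto] at hμ'
  have key : ∀ g : C(Z, ℝ), Tendsto (fun n => birkhoffAverage ℝ T g (k n) (z n)) U
      (𝓝 (∫ w, g w ∂(μ : Measure Z))) := by
    intro g
    refine (hμ' (BoundedContinuousFunction.mkOfCompact g)).congr fun n => ?_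
    exact integral_empiricalMeasure T (k n) (z n) g.continuous.stronglyMeasurable
  refine ⟨μ, ⟨hT.measurable, ?_⟩, fun g c h => ge_of_tendsto (key g) (Eventually.of_forall h)⟩
  have := Measure.isProbabilityMeasure_map (μ := (μ : Measure Z)) hT.aemeasurable
  refine ext_of_forall_integral_eq_of_IsFiniteMeasure fun f => ?_
  rw [integral_map hT.aemeasurable f.continuous.aestronglyMeasurable]
  have h1 := key ⟨f, f.continuous⟩
  have h2 := key ⟨fun w => f (T w), f.continuous.comp hT⟩
  -- Averages along an orbit segment and along its translate differ by two boundary terms.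
  have h3 : Tendsto (fun n => birkhoffAverage ℝ T (fun w => f (T w)) (k n) (z n)
      - birkhoffAverage ℝ T f (k n) (z n)) U (𝓝 0) := by
    have h4 : Tendsto (fun n => ((k n : ℝ))⁻¹ * (2 * ‖f‖)) U (𝓝 0) := by
      have := ((tendsto_natCast_atTop_atTop (R := ℝ)).comp hk).inv_tendsto_atTop.mul_const (2 * ‖f‖)
      rw [zero_mul] at this
      exact this.mono_left hU
    refine squeeze_zero_norm (fun n => ?_) h4
    have : birkhoffAverage ℝ T (fun w => f (T w)) (k n) (z n)
        = birkhoffAverage ℝ T f (k n) (T (z n)) := by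
      simp only [birkhoffAverage, birkhoffSum, ← Function.iterate_succ_apply,
        Function.iterate_succ_apply']
    rw [this, birkhoffAverage_apply_sub_birkhoffAverage, norm_smul, norm_inv, Real.norm_natCast]
    gcongr
    calc ‖f (T^[k n] (z n)) - f (z n)‖ ≤ ‖f (T^[k n] (z n))‖ + ‖f (z n)‖ := norm_sub_le _ _
      _ ≤ ‖f‖ + ‖f‖ := add_le_add (f.norm_coe_le_norm _) (f.norm_coe_le_norm _)
      _ = 2 * ‖f‖ := by ring
  exact sub_eq_zero.1 (tendsto_nhds_unique (h2.sub h1) h3)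

theorem exists_invariant_probabilityMeasure {Z : Type*} [MetricSpace Z] [CompactSpace Z]
    [MeasurableSpace Z] [BorelSpace Z] [Nonempty Z] {T : Z → Z} (hT : Continuous T) :
    ∃ μ : ProbabilityMeasure Z, MeasurePreserving T (μ : Measure Z) (μ : Measure Z) := by
  obtain ⟨μ, h, -⟩ := exists_invariant_measure hT (fun n => n + 1) (by simp)
    (tendsto_add_atTop_nat 1) (fun _ => Classical.arbitrary Z)
  exact ⟨μ, h⟩

/-- Self-joinings of a uniquely ergodic system with prescribed lower bounds for integrals: the
measure `l` is obtained from orbit segments of `φ × φ`, and its marginals are invariant, hence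
equal to the unique invariant measure. -/
theorem exists_selfJoining {X : Type*} [MetricSpace X] [CompactSpace X] [MeasurableSpace X]
    [BorelSpace X] {φ : X ≃ₜ X} {μ : ProbabilityMeasure X} (hμ : IsUniqueInvariantMeasure φ μ)
    (k : ℕ → ℕ) (hk0 : ∀ n, k n ≠ 0) (hk : Tendsto k atTop atTop) (z : ℕ → X × X) :
    ∃ l : Measure (X × X), IsProbabilityMeasure l ∧
      MeasurePreserving Prod.fst l (μ : Measure X) ∧ MeasurePreserving Prod.snd l (μ : Measure X) ∧
      ∀ g : C(X × X, ℝ), ∀ c : ℝ, (∀ n, c ≤ birkhoffAverage ℝ (Prod.map φ φ) g (k n) (z n)) →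
        c ≤ ∫ w, g w ∂l := by
  obtain ⟨l, hl, hg⟩ := exists_invariant_measure (φ.continuous.prodMap φ.continuous) k hk0 hk z
  have marginal : ∀ p : X × X → X, Continuous p → (∀ w, p (Prod.map φ φ w) = φ (p w)) →
      MeasurePreserving p (l : Measure (X × X)) (μ : Measure X) := by
    intro p hp hs
    refine ⟨hp.measurable, ?_⟩
    have h := hμ.unique (l.map hp.aemeasurable) ⟨φ.measurable, ?_⟩
    · exact congrArg (fun m : ProbabilityMeasure X => (m : Measure X)) h
    · simp only [ProbabilityMeasure.toMeasure_map]
      rw [Measure.map_map φ.measurable hp.measurable]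
      conv_rhs => rw [← hl.map_eq, Measure.map_map hp.measurable hl.measurable]
      congr 1
      ext w
      exact (hs w).symm
  exact ⟨l, inferInstance, marginal _ continuous_fst fun _ => rfl,
    marginal _ continuous_snd fun _ => rfl, hg⟩

/-! ### Consequences for fibres and equicontinuous factors -/

theorem IsFactor.iterate {X : Type*} {Y : Type*} [TopologicalSpace X] [TopologicalSpace Y]
    {φ : X ≃ₜ X} {ψ : Y ≃ₜ Y} {π : X → Y} (h : IsFactor φ ψ π) (n : ℕ) (x : X) :
    π ((φ : X → X)^[n] x) = (ψ : Y → Y)^[n] (π x) :=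
  Function.Semiconj.iterate_right (f := π) h.semiconj n x

theorem iterate_prodMap_apply {X : Type*} (f : X → X) (n : ℕ) (w : X × X) :
    (Prod.map f f)^[n] w = (f^[n] w.1, f^[n] w.2) := by
  rw [Prod.map_iterate]; rfl

/-- If the orbits in some fibres stayed apart on average, a self-joining of the invariant measure
would be carried by the fibre product of `X` with itself but not by the diagonal, although `π` is
injective on a set of full measure. -/
theorem IsIsomorphicExtension.fibrewiseMeanSmall {X : Type*} {Y : Type*}
    [MetricSpace X] [CompactSpace X] [MeasurableSpace X] [BorelSpace X]
    [MetricSpace Y] [MeasurableSpace Y] {φ : X ≃ₜ X} {ψ : Y ≃ₜ Y} {π : X → Y}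
    (hπ : IsFactor φ ψ π) (h : IsIsomorphicExtension φ ψ π) : FibrewiseMeanSmall φ π := by
  obtain ⟨μ, ν, hμ, -, -, A, B, hA, -, hμA, -, hbij, -, -⟩ := h
  intro ε hε
  by_contra! hcon
  choose x y hxy hle using fun n : ℕ => hcon (n + 1) (by omega)
  obtain ⟨l, hl, hfst, hsnd, hg⟩ := exists_selfJoining hμ (fun n => n + 2) (by simp)
    (tendsto_add_atTop_nat 2) (fun n => (x n, y n))
  have hfib : ∀ᵐ w ∂l, π w.1 = π w.2 := by
    have hc : Continuous fun w : X × X => dist (π w.1) (π w.2) :=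
      (hπ.continuous.comp continuous_fst).dist (hπ.continuous.comp continuous_snd)
    have h0 : 0 ≤ ∫ w, -dist (π w.1) (π w.2) ∂l := by
      refine hg ⟨fun w => -dist (π w.1) (π w.2), hc.neg⟩ 0 fun n => ?_
      simp [birkhoffAverage, birkhoffSum, iterate_prodMap_apply, hπ.iterate, hxy]
    rw [integral_neg] at h0
    have h1 : ∫ w, dist (π w.1) (π w.2) ∂l = 0 :=
      le_antisymm (by linarith) (integral_nonneg fun _ => dist_nonneg)
    rw [integral_eq_zero_iff_of_nonneg (fun _ => dist_nonneg)
      (hc.integrable_of_hasCompactSupport (HasCompactSupport.of_compactSpace _))] at h1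
    filter_upwards [h1] with w hw using dist_eq_zero.1 hw
  have hA' : ∀ᵐ a ∂(μ : Measure X), a ∈ A := by
    refine (mem_ae_iff_prob_eq_one hA).2 ?_
    rw [← ProbabilityMeasure.ennreal_coeFn_eq_coeFn_toMeasure, hμA, ENNReal.coe_one]
  have hdiag : ∀ᵐ w ∂l, dist w.1 w.2 = 0 := by
    filter_upwards [hfib, hfst.quasiMeasurePreserving.ae hA',
      hsnd.quasiMeasurePreserving.ae hA'] with w h1 h2 h3
    exact dist_eq_zero.2 (hbij.injOn h2 h3 h1)
  have hlow : ε / 2 ≤ ∫ w, dist w.1 w.2 ∂l := by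
    refine hg ⟨fun w => dist w.1 w.2, continuous_dist⟩ (ε / 2) fun n => ?_
    have := hle n
    simp only [birkhoffAverage, birkhoffSum, iterate_prodMap_apply, ContinuousMap.coe_mk,
      smul_eq_mul]
    set S := ∑ i ∈ Finset.range (n + 2), dist ((φ : X → X)^[i] (x n)) ((φ : X → X)^[i] (y n))
    -- The averages in `FibrewiseMeanSmall` have `K + 1` terms but are divided by `K`.
    have hS : ε * (n + 1) ≤ S := by
      rw [one_div, inv_mul_eq_div, le_div_iff₀ (by positivity)] at this
      exact_mod_cast this
    rw [inv_mul_eq_div, le_div_iff₀ (by positivity)]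
    push_cast
    nlinarith [mul_nonneg hε.le (Nat.cast_nonneg (α := ℝ) n)]
  rw [integral_congr_ae hdiag] at hlow
  simp at hlow
  linarith

/-- A fibrewise small average makes the distance of two orbits small at some time, and doing so
along backward orbits gives such times that are nonpositive; forward equicontinuity transports
this to time zero. -/
theorem FibrewiseMeanSmall.eq_of_equicontinuous {X : Type*} {Y : Type*} {Z : Type*}
    [MetricSpace X] [CompactSpace X] [TopologicalSpace Y] [MetricSpace Z]
    {φ : X ≃ₜ X} {ψ : Y ≃ₜ Y} {π : X → Y} (hπ : IsFactor φ ψ π) (h : FibrewiseMeanSmall φ π)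
    {ρ : Z ≃ₜ Z} {p : X → Z} (hρ : IsEquicontinuous ρ) (hp : IsFactor φ ρ p) {x y : X}
    (hxy : π x = π y) : p x = p y := by
  refine eq_of_forall_dist_le fun ε hε => ?_
  obtain ⟨δ, hδ, hδε⟩ := Metric.uniformEquicontinuous_iff.1 hρ ε hε
  obtain ⟨η, hη, hηδ⟩ := Metric.uniformContinuous_iff.1
    (CompactSpace.uniformContinuous_of_continuous hp.continuous) δ hδ
  obtain ⟨K, hK, hsmall⟩ := h η hη
  set x' := (φ.symm : X → X)^[K] x
  set y' := (φ.symm : X → X)^[K] y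
  have hinv : ∀ w, (φ : X → X)^[K] ((φ.symm : X → X)^[K] w) = w := fun w =>
    (Function.LeftInverse.iterate φ.apply_symm_apply K) w
  have hinvψ : Function.Injective (ψ : Y → Y)^[K] := ψ.injective.iterate K
  have hxy' : π x' = π y' := hinvψ (by
    rw [← hπ.iterate, ← hπ.iterate, hinv, hinv, hxy])
  have hS := hsmall x' y' hxy'
  obtain ⟨i, hi, hiη⟩ : ∃ i ∈ Finset.range (K + 1),
      dist ((φ : X → X)^[i] x') ((φ : X → X)^[i] y') < η := by
    by_contra! hcon
    have h1 := Finset.card_nsmul_le_sum _ _ _ hcon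
    rw [Finset.card_range, nsmul_eq_mul] at h1
    have hK' : (0 : ℝ) < K := by exact_mod_cast hK
    rw [one_div, inv_mul_eq_div, div_lt_iff₀ hK'] at hS
    push_cast at h1
    nlinarith
  have hiK : i ≤ K := Nat.lt_succ_iff.1 (Finset.mem_range.1 hi)
  have hback : ∀ w, (ρ : Z → Z)^[K - i] (p ((φ : X → X)^[i] ((φ.symm : X → X)^[K] w))) = p w := by
    intro w
    rw [← hp.iterate, ← Function.iterate_add_apply, Nat.sub_add_cancel hiK, hinv]
  have := hδε _ _ (hηδ hiη) (K - i)
  rw [hback, hback] at this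
  exact this.le

theorem FibrewiseMeanSmall.isMaximalEquicontinuousFactor {X : Type u} {Y : Type v}
    [MetricSpace X] [CompactSpace X] [MetricSpace Y]
    {φ : X ≃ₜ X} {ψ : Y ≃ₜ Y} {π : X → Y} (hπ : IsFactor φ ψ π) (hψ : IsEquicontinuous ψ)
    (h : FibrewiseMeanSmall φ π) : IsMaximalEquicontinuousFactor φ ψ π := by
  refine ⟨hπ, hψ, fun Z _ _ ρ p hρ hp => ?_⟩
  have hquot : IsQuotientMap π :=
    hπ.continuous.isClosedMap.isQuotientMap hπ.continuous hπ.surjective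
  let s := Function.surjInv hπ.surjective
  have hs : ∀ y, π (s y) = y := Function.surjInv_eq hπ.surjective
  have hpq : p = (p ∘ s) ∘ π := funext fun x =>
    h.eq_of_equicontinuous hπ hρ hp (hs (π x)).symm
  refine ⟨p ∘ s, ⟨⟨?_, ?_, fun y => ?_⟩, hpq⟩, ?_⟩
  · rw [hquot.continuous_iff, ← hpq]
    exact hp.continuous
  · intro z
    obtain ⟨x, rfl⟩ := hp.surjective z
    exact ⟨π x, (congrFun hpq x).symm⟩
  · obtain ⟨x, rfl⟩ := hπ.surjective y
    have h1 := congrFun hpq (φ x)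
    have h2 := congrFun hpq x
    simp only [Function.comp_apply] at h1 h2 ⊢
    rw [← hπ.semiconj, ← h1, hp.semiconj, ← h2]
  · rintro q ⟨-, hq⟩
    exact hπ.surjective.injective_comp_right (hq.symm.trans hpq)

/-! ### Conditional measures over the factor -/

/-- The average of the distance along orbits has the same integral as the distance, so it is
enough that such averages be small on the fibre product. -/
theorem FibrewiseMeanSmall.ae_fst_eq_snd {X : Type*} {Y : Type*}
    [MetricSpace X] [CompactSpace X] [MeasurableSpace X] [BorelSpace X]
    {φ : X ≃ₜ X} {π : X → Y} (h : FibrewiseMeanSmall φ π)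
    {l : Measure (X × X)} [IsProbabilityMeasure l]
    (hl : MeasurePreserving (Prod.map φ φ) l l) (hfib : ∀ᵐ w ∂l, π w.1 = π w.2) :
    ∀ᵐ w ∂l, w.1 = w.2 := by
  have hint : Integrable (fun w : X × X => dist w.1 w.2) l :=
    continuous_dist.integrable_of_hasCompactSupport (HasCompactSupport.of_compactSpace _)
  have h0 : ∫ w, dist w.1 w.2 ∂l ≤ 0 := by
    refine le_of_forall_pos_le_add fun ε hε => ?_
    obtain ⟨K, hK, hsmall⟩ := h ε hε
    rw [zero_add, ← integral_birkhoffAverage hl hint K.succ_ne_zero]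
    have hle : ∀ᵐ w ∂l, birkhoffAverage ℝ (Prod.map φ φ) (fun w : X × X => dist w.1 w.2)
        (K + 1) w ≤ ε := by
      filter_upwards [hfib] with w hw
      refine le_trans ?_ (hsmall _ _ hw).le
      simp only [birkhoffAverage, birkhoffSum, iterate_prodMap_apply, smul_eq_mul, one_div]
      gcongr
      omega
    calc ∫ w, birkhoffAverage ℝ (Prod.map φ φ) (fun w : X × X => dist w.1 w.2) (K + 1) w ∂l
        ≤ ∫ _, ε ∂l := by
          refine integral_mono_of_nonneg (Eventually.of_forall fun w => ?_)
            (integrable_const ε) hle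
          simp only [birkhoffAverage, birkhoffSum, smul_eq_mul, Pi.zero_apply]
          positivity
      _ = ε := by simp
  have h1 := le_antisymm h0 (integral_nonneg fun _ => dist_nonneg)
  rw [integral_eq_zero_iff_of_nonneg (fun _ => dist_nonneg) hint] at h1
  filter_upwards [h1] with w hw using dist_eq_zero.1 hw

/-- Disintegration of an invariant measure over a factor. The equivariance of the conditional
measures is a consequence of their almost everywhere uniqueness. -/
theorem exists_equivariant_disintegration {X : Type*} {Y : Type*}
    [MeasurableSpace X] [StandardBorelSpace X] [Nonempty X] [MeasurableSpace Y] [MeasurableEq Y]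
    {φ : X ≃ᵐ X} {ψ : Y ≃ᵐ Y} {π : X → Y} (hs : ∀ x, π (φ x) = ψ (π x))
    {μ : Measure X} [IsProbabilityMeasure μ] {ν : Measure Y} [IsProbabilityMeasure ν]
    (hμ : MeasurePreserving φ μ μ) (hν : MeasurePreserving ψ ν ν) (hπ : MeasurePreserving π μ ν) :
    ∃ κ : Kernel Y X, IsMarkovKernel κ ∧ ν ⊗ₘ κ = μ.map (fun x => (π x, x)) ∧
      (∀ᵐ y ∂ν, ∀ᵐ x ∂κ y, π x = y) ∧ ∀ᵐ y ∂ν, κ (ψ y) = (κ y).map φ := by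
  have hg : Measurable fun x => (π x, x) := hπ.measurable.prodMk measurable_id
  set r : Measure (Y × X) := μ.map (fun x => (π x, x)) with hr
  have hrp : IsProbabilityMeasure r := Measure.isProbabilityMeasure_map hg.aemeasurable
  have hfst : r.fst = ν := by
    rw [Measure.fst, hr, Measure.map_map measurable_fst hg]
    exact hπ.map_eq
  have hdis : ν ⊗ₘ r.condKernel = r := by
    rw [← hfst]; exact r.disintegrate r.condKernel
  refine ⟨r.condKernel, inferInstance, hdis, ?_, ?_⟩
  · refine Measure.ae_ae_of_ae_compProd (p := fun w : Y × X => π w.2 = w.1) ?_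
    have hsm : MeasurableSet {w : Y × X | π w.2 = w.1} :=
      measurableSet_eq_fun (hπ.measurable.comp measurable_snd) measurable_fst
    rw [hdis, hr, ae_map_iff hg.aemeasurable hsm]
    simp
  · let κ' : Kernel Y X := (r.condKernel.comap ψ ψ.measurable).map φ.symm
    have hκ'm : IsMarkovKernel κ' := Kernel.IsMarkovKernel.map _ φ.symm.measurable
    have hT : MeasurePreserving (fun w : Y × X => (ψ.symm w.1, φ.symm w.2)) r r := by
      have hm : Measurable fun w : Y × X => (ψ.symm w.1, φ.symm w.2) := by fun_prop
      refine ⟨hm, ?_⟩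
      rw [hr, Measure.map_map hm hg]
      conv_rhs => rw [← (hμ.symm φ).map_eq, Measure.map_map hg φ.symm.measurable]
      congr 1
      ext x
      · have := hs (φ.symm x)
        simp only [MeasurableEquiv.apply_symm_apply] at this
        simp [this]
      · rfl
    have hκ' : r = r.fst ⊗ₘ κ' := by
      rw [hfst]
      ext s hsm
      rw [Measure.compProd_apply hsm]
      have h1 : ∀ y, κ' y (Prod.mk y ⁻¹' s)
          = r.condKernel (ψ y)
            (Prod.mk (ψ y) ⁻¹' ((fun w : Y × X => (ψ.symm w.1, φ.symm w.2)) ⁻¹' s)) := by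
        intro y
        rw [Kernel.map_apply' _ φ.symm.measurable _ (measurable_prodMk_left hsm),
          Kernel.comap_apply]
        congr 1
        ext x
        simp
      simp only [h1]
      have hs' := hT.measurable hsm
      rw [hν.lintegral_comp (f := fun y => r.condKernel y (Prod.mk y ⁻¹'
        ((fun w : Y × X => (ψ.symm w.1, φ.symm w.2)) ⁻¹' s)))
        (Kernel.measurable_kernel_prodMk_left hs'), ← Measure.compProd_apply hs', hdis,
        hT.measure_preimage hsm.nullMeasurableSet]
    have := eq_condKernel_of_measure_eq_compProd κ' hκ'
    rw [hfst] at this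
    filter_upwards [this] with y hy
    rw [← hy, Kernel.map_apply _ φ.symm.measurable, Kernel.comap_apply,
      Measure.map_map φ.measurable φ.symm.measurable]
    simp

/-- Two probability measures whose product is carried by the diagonal are the same point mass. -/
theorem exists_eq_dirac_of_ae_eq {X : Type*} [MeasurableSpace X]
    {m₁ m₂ : Measure X} [IsProbabilityMeasure m₁] [IsProbabilityMeasure m₂]
    (h : ∀ᵐ w ∂m₁.prod m₂, w.1 = w.2) : ∃ x, m₁ = Measure.dirac x ∧ m₂ = Measure.dirac x := by
  have hd : ∀ (m : Measure X) [IsProbabilityMeasure m] (a : X), (∀ᵐ b ∂m, b = a) →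
      m = Measure.dirac a := by
    intro m _ a ha
    have : m.map id = m.map fun _ => a := Measure.map_congr ha
    simpa using this
  have h' := Measure.ae_ae_of_ae_prod h
  obtain ⟨a, ha⟩ := h'.exists
  have h2 : m₂ = Measure.dirac a := hd m₂ a (ha.mono fun b hb => hb.symm)
  refine ⟨a, hd m₁ a ?_, h2⟩
  filter_upwards [h'] with b hb
  obtain ⟨c, hc, hc'⟩ := (hb.and ha).exists
  exact hc.trans hc'.symm

/-- The relatively independent joining of two invariant measures over the factor is carried by the
diagonal, so the conditional measures of both are the same point masses. -/
theorem FibrewiseMeanSmall.exists_eq_dirac {X : Type*} {Y : Type*}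
    [MetricSpace X] [CompactSpace X] [MeasurableSpace X] [BorelSpace X]
    [MeasurableSpace Y] [MeasurableEq Y] {φ : X ≃ₜ X} {ψ : Y ≃ᵐ Y} {π : X → Y}
    (h : FibrewiseMeanSmall φ π) (hπ : Measurable π)
    {ν : Measure Y} [IsProbabilityMeasure ν] (hν : MeasurePreserving ψ ν ν)
    {κ₁ κ₂ : Kernel Y X} [IsMarkovKernel κ₁] [IsMarkovKernel κ₂]
    (hf₁ : ∀ᵐ y ∂ν, ∀ᵐ x ∂κ₁ y, π x = y) (he₁ : ∀ᵐ y ∂ν, κ₁ (ψ y) = (κ₁ y).map φ)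
    (hf₂ : ∀ᵐ y ∂ν, ∀ᵐ x ∂κ₂ y, π x = y) (he₂ : ∀ᵐ y ∂ν, κ₂ (ψ y) = (κ₂ y).map φ) :
    ∀ᵐ y ∂ν, ∃ x, κ₁ y = Measure.dirac x ∧ κ₂ y = Measure.dirac x := by
  have hφ : Measurable φ := φ.measurable
  let l : Measure (X × X) := ν.bind (κ₁ ×ₖ κ₂)
  have hm : AEMeasurable (κ₁ ×ₖ κ₂) ν := (κ₁ ×ₖ κ₂).measurable.aemeasurable
  have hl : MeasurePreserving (Prod.map φ φ) l l := by
    refine ⟨hφ.prodMap hφ, ?_⟩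
    ext s hs
    have hs' := (hφ.prodMap hφ) hs
    rw [Measure.map_apply (hφ.prodMap hφ) hs, Measure.bind_apply hs' hm,
      Measure.bind_apply hs hm,
      ← hν.lintegral_comp ((κ₁ ×ₖ κ₂).measurable_coe hs)]
    refine lintegral_congr_ae ?_
    filter_upwards [he₁, he₂] with y h₁ h₂
    rw [Kernel.prod_apply, Kernel.prod_apply, h₁, h₂, Measure.map_prod_map _ _ hφ hφ,
      Measure.map_apply (hφ.prodMap hφ) hs]
  have hfib : ∀ᵐ w ∂l, π w.1 = π w.2 := by
    have hs : MeasurableSet {w : X × X | π w.1 = π w.2} :=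
      measurableSet_eq_fun (hπ.comp measurable_fst) (hπ.comp measurable_snd)
    rw [ae_iff, ← Set.compl_ofPred, Measure.bind_apply hs.compl hm, lintegral_eq_zero_iff
      ((κ₁ ×ₖ κ₂).measurable_coe hs.compl)]
    filter_upwards [hf₁, hf₂] with y h₁ h₂
    have h3 : ∀ᵐ w ∂(κ₁ y).prod (κ₂ y), π w.1 = π w.2 := by
      filter_upwards [Measure.quasiMeasurePreserving_fst.ae h₁,
        Measure.quasiMeasurePreserving_snd.ae h₂] with w h4 h5 using h4.trans h5.symm
    rw [Kernel.prod_apply]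
    exact h3
  have hprob : IsProbabilityMeasure l := isProbabilityMeasure_bind hm (by
    exact Eventually.of_forall fun y => inferInstance)
  filter_upwards [Measure.ae_ae_of_ae_bind hm (h.ae_fst_eq_snd hl hfib)] with y hy
  rw [Kernel.prod_apply] at hy
  exact exists_eq_dirac_of_ae_eq hy

/-- The set on which `π` is inverted consists of the points `x` whose own conditional measure, the
one over `π x`, is the point mass at `x`. -/
theorem FibrewiseMeanSmall.isIsomorphicExtension {X : Type*} {Y : Type*}
    [MetricSpace X] [CompactSpace X] [MeasurableSpace X] [BorelSpace X]
    [MetricSpace Y] [CompactSpace Y] [MeasurableSpace Y] [BorelSpace Y]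
    {φ : X ≃ₜ X} {ψ : Y ≃ₜ Y} {π : X → Y} (hπ : IsFactor φ ψ π) (hψ : UniquelyErgodic ψ)
    (h : FibrewiseMeanSmall φ π) : IsIsomorphicExtension φ ψ π := by
  obtain ⟨ν, hν⟩ := hψ
  have : Nonempty Y := ν.nonempty
  have : Nonempty X := ‹Nonempty Y›.elim fun y => ⟨(hπ.surjective y).choose⟩
  have hπm := hπ.continuous.measurable
  have hgm : Measurable fun x => (π x, x) := hπm.prodMk measurable_id
  have hpush : ∀ m : ProbabilityMeasure X, MeasurePreserving φ (m : Measure X) (m : Measure X) →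
      MeasurePreserving π (m : Measure X) (ν : Measure Y) := by
    intro m hm
    refine ⟨hπm, ?_⟩
    have h1 := hν.unique (m.map hπm.aemeasurable) ⟨ψ.measurable, ?_⟩
    · exact congrArg (fun m : ProbabilityMeasure Y => (m : Measure Y)) h1
    · simp only [ProbabilityMeasure.toMeasure_map]
      rw [Measure.map_map ψ.measurable hπm]
      conv_rhs => rw [← hm.map_eq, Measure.map_map hπm φ.measurable]
      congr 1
      ext x
      exact (hπ.semiconj x).symm
  have hdis := fun (m : ProbabilityMeasure X)
      (hm : MeasurePreserving φ (m : Measure X) (m : Measure X)) =>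
    exists_equivariant_disintegration (φ := φ.toMeasurableEquiv) (ψ := ψ.toMeasurableEquiv)
      hπ.semiconj hm hν.invariant (hpush m hm)
  have hdirac := fun (κ₁ κ₂ : Kernel Y X) (_ : IsMarkovKernel κ₁) (_ : IsMarkovKernel κ₂) =>
    h.exists_eq_dirac (ψ := ψ.toMeasurableEquiv) hπm hν.invariant (κ₁ := κ₁) (κ₂ := κ₂)
  obtain ⟨μ, hμ⟩ := exists_invariant_probabilityMeasure φ.continuous
  obtain ⟨κ, hκ, hκd, hκf, hκe⟩ := hdis μ hμ
  refine ⟨μ, ν, ⟨hμ, fun m hm => ?_⟩, hν, hpush μ hμ, ?_⟩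
  · obtain ⟨η, hη, hηd, hηf, hηe⟩ := hdis m hm
    have hηκ : ν ⊗ₘ η = ν ⊗ₘ κ := Measure.compProd_congr (by
      filter_upwards [hdirac η κ hη hκ hηf hηe hκf hκe] with y ⟨x, h1, h2⟩
      rw [h1, h2])
    rw [hηd, hκd] at hηκ
    have h2 := congrArg (Measure.map Prod.snd) hηκ
    rw [Measure.map_map measurable_snd hgm, Measure.map_map measurable_snd hgm] at h2
    simp only [Function.comp_def, Measure.map_id'] at h2
    exact Subtype.ext h2
  · let A : Set X := {x | κ (π x) {x} = 1}
    have hsing : Measurable fun w : Y × X => κ w.1 {w.2} := by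
      have := Kernel.measurable_kernel_prodMk_left (κ := κ.comap Prod.fst measurable_fst)
        (t := {p : (Y × X) × X | p.2 = p.1.2})
        (measurableSet_eq_fun measurable_snd (measurable_snd.comp measurable_fst))
      exact this
    have hA : MeasurableSet A := (hsing.comp hgm) (measurableSet_singleton 1)
    have hinj : Set.InjOn π A := by
      intro x hx x' hx' hxx'
      by_contra hne
      have hx'1 : κ (π x) {x'} = 1 := by rw [hxx']; exact hx'
      have hle := prob_le_one (μ := κ (π x)) (s := {x} ∪ {x'})
      rw [measure_union (by simpa using hne) (measurableSet_singleton x'),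
        show κ (π x) {x} = 1 from hx, hx'1] at hle
      norm_num at hle
    have hμA : (μ : Measure X) A = 1 := by
      rw [← mem_ae_iff_prob_eq_one hA]
      have h1 : ∀ᵐ w ∂((ν : Measure Y) ⊗ₘ κ), κ w.1 {w.2} = 1 := by
        refine Measure.ae_compProd_of_ae_ae (hsing (measurableSet_singleton 1)) ?_
        filter_upwards [hdirac κ κ hκ hκ hκf hκe hκf hκe] with y ⟨x, hx, _⟩
        simp [hx]
      rw [hκd] at h1
      exact ae_of_ae_map hgm.aemeasurable h1
    have himage : ∀ S ⊆ A, MeasurableSet S → MeasurableSet (π '' S) := fun S hS hSm =>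
      hSm.image_of_continuousOn_injOn hπ.continuous.continuousOn (hinj.mono hS)
    refine ⟨A, π '' A, hA, himage A subset_rfl hA, ?_, ?_, hinj.bijOn_image, himage,
      fun x _ => hπ.semiconj x⟩
    · rw [← ENNReal.coe_inj, ProbabilityMeasure.ennreal_coeFn_eq_coeFn_toMeasure, hμA,
        ENNReal.coe_one]
    · rw [← ENNReal.coe_inj, ProbabilityMeasure.ennreal_coeFn_eq_coeFn_toMeasure,
        ENNReal.coe_one, ← (hpush μ hμ).measure_preimage (himage A subset_rfl hA).nullMeasurableSet]
      exact le_antisymm prob_le_one (hμA.symm.le.trans (measure_mono (Set.subset_preimage_image π A)))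

/-! ### Unique ergodicity in terms of averages -/

/-- Unique ergodicity makes the averages of a continuous function nearly constant at some time:
otherwise some self-joining would give the function different integrals with respect to its two
marginals. -/
theorem UniquelyErgodic.exists_birkhoffAverage_sub_lt {Y : Type*} [MetricSpace Y] [CompactSpace Y]
    [MeasurableSpace Y] [BorelSpace Y] {ψ : Y ≃ₜ Y} (h : UniquelyErgodic ψ) (f : C(Y, ℝ)) {ε : ℝ}
    (hε : 0 < ε) : ∃ N : ℕ, N ≠ 0 ∧
      ∀ w : Y × Y, birkhoffAverage ℝ ψ f N w.1 - birkhoffAverage ℝ ψ f N w.2 < ε := by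
  obtain ⟨ν, hν⟩ := h
  by_contra! hcon
  choose w hw using fun n : ℕ => hcon (n + 1) n.succ_ne_zero
  obtain ⟨l, hl, hfst, hsnd, hg⟩ := exists_selfJoining hν (fun n => n + 1) (by simp)
    (tendsto_add_atTop_nat 1) w
  have hlow := hg ⟨fun w => f w.1 - f w.2,
    (f.continuous.comp continuous_fst).sub (f.continuous.comp continuous_snd)⟩ ε fun n => by
      refine (hw n).trans_eq ?_
      simp only [birkhoffAverage, birkhoffSum, iterate_prodMap_apply, ContinuousMap.coe_mk,
        Finset.sum_sub_distrib, smul_sub]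
  have hint : Integrable f (ν : Measure Y) :=
    f.continuous.integrable_of_hasCompactSupport (HasCompactSupport.of_compactSpace _)
  have hmarg : ∀ p : Y × Y → Y, MeasurePreserving p l (ν : Measure Y) →
      ∫ w, f (p w) ∂l = ∫ y, f y ∂(ν : Measure Y) := by
    intro p hp
    rw [← hp.map_eq, integral_map hp.aemeasurable f.continuous.aestronglyMeasurable]
  simp only [ContinuousMap.coe_mk] at hlow
  have hsub : ∫ w : Y × Y, (f w.1 - f w.2) ∂l = ∫ w : Y × Y, f w.1 ∂l - ∫ w : Y × Y, f w.2 ∂l :=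
    integral_sub (hfst.integrable_comp_of_integrable hint)
      (hsnd.integrable_comp_of_integrable hint)
  rw [hsub, hmarg _ hfst, hmarg _ hsnd, sub_self] at hlow
  exact hlow.not_gt hε

/-- It suffices to control the averages of a dense set of functions; when that set is countable,
this writes unique ergodicity as countably many conditions. -/
theorem uniquelyErgodic_of_birkhoffAverage_sub_lt {Y : Type*} [MetricSpace Y] [CompactSpace Y]
    [MeasurableSpace Y] [BorelSpace Y] [Nonempty Y] {ψ : Y ≃ₜ Y} {D : Set C(Y, ℝ)} (hD : Dense D)
    (h : ∀ f ∈ D, ∀ ε : ℝ, 0 < ε → ∃ N : ℕ, N ≠ 0 ∧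
      ∀ w : Y × Y, birkhoffAverage ℝ ψ f N w.1 - birkhoffAverage ℝ ψ f N w.2 < ε) :
    UniquelyErgodic ψ := by
  have hint : ∀ (m : ProbabilityMeasure Y) (f : Y → ℝ), Continuous f →
      Integrable f (m : Measure Y) := fun m f hf =>
    hf.integrable_of_hasCompactSupport (HasCompactSupport.of_compactSpace _)
  have hle : ∀ m₁ m₂ : ProbabilityMeasure Y,
      MeasurePreserving ψ (m₁ : Measure Y) (m₁ : Measure Y) →
      MeasurePreserving ψ (m₂ : Measure Y) (m₂ : Measure Y) → ∀ f ∈ D,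
      ∫ y, f y ∂(m₁ : Measure Y) ≤ ∫ y, f y ∂(m₂ : Measure Y) := by
    intro m₁ m₂ h₁ h₂ f hf
    refine le_of_forall_pos_le_add fun ε hε => ?_
    obtain ⟨N, hN, hosc⟩ := h f hf ε hε
    have hc : Continuous (birkhoffAverage ℝ ψ f N) := by
      change Continuous fun y => (N : ℝ)⁻¹ * ∑ i ∈ Finset.range N, f ((ψ : Y → Y)^[i] y)
      exact continuous_const.mul (continuous_finsetSum _ fun i _ =>
        f.continuous.comp (ψ.continuous.iterate i))
    rw [← integral_birkhoffAverage h₁ (hint m₁ f f.continuous) hN,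
      ← integral_birkhoffAverage h₂ (hint m₂ f f.continuous) hN]
    have h3 : ∀ b, ∫ a, birkhoffAverage ℝ ψ f N a ∂(m₁ : Measure Y)
        ≤ birkhoffAverage ℝ ψ f N b + ε := fun b => by
      calc ∫ a, birkhoffAverage ℝ ψ f N a ∂(m₁ : Measure Y)
          ≤ ∫ _, (birkhoffAverage ℝ ψ f N b + ε) ∂(m₁ : Measure Y) :=
            integral_mono (hint m₁ _ hc) (integrable_const _) fun a => by
              have := hosc (a, b); dsimp only at this ⊢; linarith
        _ = _ := by simp
    calc ∫ a, birkhoffAverage ℝ ψ f N a ∂(m₁ : Measure Y)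
        = ∫ _, (∫ a, birkhoffAverage ℝ ψ f N a ∂(m₁ : Measure Y)) ∂(m₂ : Measure Y) := by simp
      _ ≤ ∫ b, (birkhoffAverage ℝ ψ f N b + ε) ∂(m₂ : Measure Y) :=
          integral_mono (integrable_const _) ((hint m₂ _ hc).add (integrable_const _)) h3
      _ = _ := by rw [integral_add (hint m₂ _ hc) (integrable_const _)]; simp
  obtain ⟨ν, hν⟩ := exists_invariant_probabilityMeasure ψ.continuous
  refine ⟨ν, hν, fun m hm => Subtype.ext ?_⟩
  have hcont : ∀ m : ProbabilityMeasure Y,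
      Continuous fun f : C(Y, ℝ) => ∫ y, f y ∂(m : Measure Y) := fun m => by
    refine (LipschitzWith.of_dist_le_mul (K := 1) fun f g => ?_).continuous
    rw [NNReal.coe_one, one_mul, dist_eq_norm,
      ← integral_sub (hint m f f.continuous) (hint m g g.continuous)]
    refine (norm_integral_le_of_norm_le_const (C := dist f g)
      (Eventually.of_forall fun y => ?_)).trans_eq (by simp)
    rw [← dist_eq_norm]
    exact ContinuousMap.dist_apply_le_dist y
  have heq := (hcont m).ext_on hD (hcont ν)
    fun f hf => le_antisymm (hle m ν hm hν f hf) (hle ν m hν hm f hf)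
  exact ext_of_forall_integral_eq_of_IsFiniteMeasure (μ := (m : Measure Y)) (ν := (ν : Measure Y))
    fun f => congrFun heq ⟨f, f.continuous⟩

/-! ### Sets of homeomorphisms -/

theorem continuous_homeomorph_iterate_apply {X : Type*} [TopologicalSpace X]
    [LocallyCompactSpace X] (n : ℕ) :
    Continuous fun a : (X ≃ₜ X) × X => (a.1 : X → X)^[n] a.2 := by
  have h1 : Continuous fun a : (X ≃ₜ X) × X => a.1 a.2 := by
    have h2 : Continuous fun φ : X ≃ₜ X => (φ : C(X, X)) :=
      continuous_fst.comp (continuous_induced_dom (f := fun φ : X ≃ₜ X =>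
        ((φ : C(X, X)), (φ.symm : C(X, X)))))
    exact (h2.comp continuous_fst).eval continuous_snd
  induction n with
  | zero => exact continuous_snd
  | succ n ih =>
    simp only [Function.iterate_succ_apply']
    exact h1.comp (continuous_fst.prodMk ih)

theorem isOpen_setOf_forall_mem_lt {A P : Type*} [TopologicalSpace A] [TopologicalSpace P]
    {C : Set P} (hC : IsCompact C) {F : A → P → ℝ} (hF : Continuous fun a : A × P => F a.1 a.2)
    (ε : ℝ) : IsOpen {a | ∀ p ∈ C, F a p < ε} := by
  refine isOpen_iff_mem_nhds.2 fun a ha => ?_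
  exact hC.eventually_forall_of_forall_eventually fun p hp =>
    (isOpen_lt hF continuous_const).mem_nhds (ha p hp)

theorem isGδ_setOf_forall_pos_exists {A : Type*} [TopologicalSpace A] {q : ℕ → Prop}
    {F : ℕ → A → ℝ → Prop} (hF : ∀ n ε, IsOpen {a | F n a ε})
    (hmono : ∀ n a ε ε', ε ≤ ε' → F n a ε → F n a ε') :
    IsGδ {a | ∀ ε : ℝ, 0 < ε → ∃ n, q n ∧ F n a ε} := by
  have : {a | ∀ ε : ℝ, 0 < ε → ∃ n, q n ∧ F n a ε}
      = ⋂ k : ℕ, ⋃ n, ⋃ _ : q n, {a | F n a (1 / ((k : ℝ) + 1))} := by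
    ext a
    simp only [Set.mem_ofPred_eq, Set.mem_iInter, Set.mem_iUnion, exists_prop]
    refine ⟨fun h k => h _ Nat.one_div_pos_of_nat, fun h ε hε => ?_⟩
    obtain ⟨k, hk⟩ := exists_nat_one_div_lt hε
    obtain ⟨n, hn, hn'⟩ := h k
    exact ⟨n, hn, hmono n a _ _ hk.le hn'⟩
  rw [this]
  exact .iInter_of_isOpen fun k => isOpen_iUnion fun n => isOpen_iUnion fun _ => hF n _

theorem isGδ_setOf_fibrewiseMeanSmall {X : Type*} {Y : Type*} [MetricSpace X] [CompactSpace X]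
    [TopologicalSpace Y] [T2Space Y] {π : X → Y} (hπ : Continuous π) :
    IsGδ {φ : X ≃ₜ X | FibrewiseMeanSmall φ π} := by
  refine isGδ_setOf_forall_pos_exists
    (F := fun K (φ : X ≃ₜ X) ε => ∀ x y : X, π x = π y → (1 / (K : ℝ)) * ∑ i ∈ Finset.range (K + 1),
      dist ((φ : X → X)^[i] x) ((φ : X → X)^[i] y) < ε) (fun K ε => ?_)
    fun n a ε ε' hε h x y hxy => (h x y hxy).trans_le hε
  have hC : IsCompact {w : X × X | π w.1 = π w.2} :=
    (isClosed_eq (hπ.comp continuous_fst) (hπ.comp continuous_snd)).isCompact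
  have := isOpen_setOf_forall_mem_lt hC (F := fun (φ : X ≃ₜ X) (w : X × X) =>
    (1 / (K : ℝ)) * ∑ i ∈ Finset.range (K + 1),
      dist ((φ : X → X)^[i] w.1) ((φ : X → X)^[i] w.2)) (continuous_const.mul
        (continuous_finsetSum _ fun i _ =>
          ((continuous_homeomorph_iterate_apply i).comp
            (continuous_fst.prodMk (continuous_fst.comp continuous_snd))).dist
          ((continuous_homeomorph_iterate_apply i).comp
            (continuous_fst.prodMk (continuous_snd.comp continuous_snd))))) ε
  simpa only [Prod.forall, Set.mem_ofPred_eq] using this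

theorem isGδ_setOf_birkhoffAverage_sub_lt {X : Type*} [MetricSpace X] [CompactSpace X]
    (f : C(X, ℝ)) :
    IsGδ {φ : X ≃ₜ X | ∀ ε : ℝ, 0 < ε → ∃ N : ℕ, N ≠ 0 ∧
      ∀ w : X × X, birkhoffAverage ℝ φ f N w.1 - birkhoffAverage ℝ φ f N w.2 < ε} := by
  refine isGδ_setOf_forall_pos_exists (F := fun N (φ : X ≃ₜ X) ε =>
      ∀ w : X × X, birkhoffAverage ℝ φ f N w.1 - birkhoffAverage ℝ φ f N w.2 < ε)
    (fun N ε => ?_) fun n a ε ε' hε h w => (h w).trans_le hε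
  have hc : Continuous fun a : (X ≃ₜ X) × X => birkhoffAverage ℝ a.1 f N a.2 := by
    change Continuous fun a : (X ≃ₜ X) × X =>
      (N : ℝ)⁻¹ * ∑ i ∈ Finset.range N, f ((a.1 : X → X)^[i] a.2)
    exact continuous_const.mul (continuous_finsetSum _ fun i _ =>
      f.continuous.comp (continuous_homeomorph_iterate_apply i))
  have := isOpen_setOf_forall_mem_lt isCompact_univ (F := fun (φ : X ≃ₜ X) (w : X × X) =>
    birkhoffAverage ℝ φ f N w.1 - birkhoffAverage ℝ φ f N w.2)
    ((hc.comp (continuous_fst.prodMk (continuous_fst.comp continuous_snd))).sub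
      (hc.comp (continuous_fst.prodMk (continuous_snd.comp continuous_snd)))) ε
  simpa only [Set.mem_univ, true_implies] using this

end TDS

theorem mainTheorem3 {X : Type*} {Y : Type*}
    [MetricSpace X] [CompactSpace X] [MeasurableSpace X] [BorelSpace X]
    [MetricSpace Y] [CompactSpace Y] [MeasurableSpace Y] [BorelSpace Y]
    (π : X → Y) (hπ_cont : Continuous π) (hπ_surj : Function.Surjective π) :
    (∀ (φ : X ≃ₜ X) (ψ : Y ≃ₜ Y), TDS.IsFactor φ ψ π → TDS.IsEquicontinuous ψ →
      TDS.UniquelyErgodic ψ →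
      ((TDS.IsMaximalEquicontinuousFactor φ ψ π ∧ TDS.IsIsomorphicExtension φ ψ π) ↔
        TDS.FibrewiseMeanSmall φ π)) ∧
    IsGδ (TDS.isoExtensions π) := by
  have key : ∀ (φ : X ≃ₜ X) (ψ : Y ≃ₜ Y), TDS.IsFactor φ ψ π → TDS.IsEquicontinuous ψ →
      TDS.UniquelyErgodic ψ →
      ((TDS.IsMaximalEquicontinuousFactor φ ψ π ∧ TDS.IsIsomorphicExtension φ ψ π) ↔
        TDS.FibrewiseMeanSmall φ π) := fun φ ψ hπ heq hue =>
    ⟨fun h => h.2.fibrewiseMeanSmall hπ, fun h =>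
      ⟨h.isMaximalEquicontinuousFactor hπ heq, h.isIsomorphicExtension hπ hue⟩⟩
  refine ⟨key, ?_⟩
  rcases isEmpty_or_nonempty Y with hY | hY
  -- Over the empty space there is no invariant probability measure.
  · have : TDS.isoExtensions π = ∅ := by
      refine Set.eq_empty_of_forall_notMem ?_
      rintro φ ⟨ψ, -, μ, ν, -⟩
      exact hY.false ν.nonempty.some
    rw [this]
    exact .empty
  obtain ⟨D, hDc, hD⟩ := TopologicalSpace.exists_countable_dense C(Y, ℝ)
  -- The system `(Y, ψ)` need not be uniquely ergodic for `φ ∈ extensions π`; its unique ergodicity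
  -- is expressed by averages along orbits of `φ`, so that `ψ` does not occur in the condition.
  let π' : C(X, Y) := ⟨π, hπ_cont⟩
  have havg : ∀ (φ : X ≃ₜ X) (ψ : Y ≃ₜ Y), TDS.IsFactor φ ψ π → ∀ (f : C(Y, ℝ)) (N : ℕ) (x : X),
      birkhoffAverage ℝ φ (f.comp π') N x = birkhoffAverage ℝ ψ f N (π x) := by
    intro φ ψ hπ f N x
    simp [birkhoffAverage, birkhoffSum, π', hπ.iterate]
  have hset : TDS.isoExtensions π = Subtype.val ⁻¹' ({φ : X ≃ₜ X | TDS.FibrewiseMeanSmall φ π} ∩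
      ⋂ f ∈ D, {φ : X ≃ₜ X | ∀ ε : ℝ, 0 < ε → ∃ N : ℕ, N ≠ 0 ∧ ∀ w : X × X,
        birkhoffAverage ℝ φ (f.comp π') N w.1 - birkhoffAverage ℝ φ (f.comp π') N w.2 < ε}) := by
    ext φ
    simp only [Set.mem_preimage, Set.mem_inter_iff, Set.mem_ofPred_eq, Set.mem_iInter]
    constructor
    · rintro ⟨ψ, hmef, hiso⟩
      have hue : TDS.UniquelyErgodic ψ := by
        obtain ⟨-, ν, -, hν, -⟩ := hiso
        exact ⟨ν, hν⟩
      refine ⟨hiso.fibrewiseMeanSmall hmef.isFactor, fun f _ ε hε => ?_⟩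
      obtain ⟨N, hN, h⟩ := hue.exists_birkhoffAverage_sub_lt f hε
      refine ⟨N, hN, fun w => ?_⟩
      rw [havg _ _ hmef.isFactor, havg _ _ hmef.isFactor]
      exact h (π w.1, π w.2)
    · rintro ⟨hsmall, havg_lt⟩
      obtain ⟨ψ, heq, hsemi⟩ := φ.2
      have hπ : TDS.IsFactor φ.1 ψ π := ⟨hπ_cont, hπ_surj, congrFun hsemi⟩
      refine ⟨ψ, (key φ.1 ψ hπ heq ?_).2 hsmall⟩
      refine TDS.uniquelyErgodic_of_birkhoffAverage_sub_lt hD fun f hf ε hε => ?_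
      obtain ⟨N, hN, h⟩ := havg_lt f hf ε hε
      refine ⟨N, hN, fun w => ?_⟩
      obtain ⟨a, ha⟩ := hπ_surj w.1
      obtain ⟨b, hb⟩ := hπ_surj w.2
      have := h (a, b)
      rwa [havg _ _ hπ, havg _ _ hπ, ha, hb] at this
  rw [hset]
  exact ((TDS.isGδ_setOf_fibrewiseMeanSmall hπ_cont).inter (.biInter hDc fun f _ =>
    TDS.isGδ_setOf_birkhoffAverage_sub_lt (f.comp π'))).preimage continuous_subtype_val
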